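/- Let $v_0$ be the root and $v_1,v_2,\dots$ the leaves of the infinite star graph, with a loop added at $v_0$. Let $(\delta_i)_{i\ge 0}$ be nonnegative initial weights with $0<\delta:=\sum_{i\ge 0}\delta_i<\infty$, and let $R=(\alpha_{j,i})_{j,i\ge 0}$ be a stochastic matrix that is irreducible, aperiodic and uniformly ergodic. The last condition means that $R$ has a stationary distribution $\pi$ (a probability vector with $\pi R=\pi$) and that there are $C>0$ and $0<\rho<1$ with $|R^n(u,v)-\pi_v|\le C\rho^n$ for all $n\ge 1$ and all states $u,v$; this $\pi$ is then unique. Let $(X_n)_{n\ge 0}$ be the vertex-reinforced random walk with $X_0=v_0$ almost surely and with vertex weights $\Delta_{n,j}$ defined as follows. Initially $\Delta_{0,j}=\delta_j$. If the walk traverses an edge $(v_i,v_0)$, $i\ge 0$ (including the loop), between times $n$ and $n+1$, then $\Delta_{n+1,j}=\Delta_{n,j}+\alpha_{i,j}$ for all $j$; otherwise the weights do not change. Given $X_0,\dots,X_n$, if $X_n=v_0$ then $X_{n+1}=v_j$ with probability $\Delta_{n,j}/\sum_k\Delta_{n,k}$, and if $X_n\neq v_0$ then $X_{n+1}=v_0$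 with probability $1$. Let $\sigma_0=0$ and, for $n\ge 1$, let $\sigma_n$ be the time of the $n$-th weight update, that is, the $n$-th time $m\ge 1$ with $X_m=v_0$. Then, as $n\to\infty$, $$\frac{\sigma_n}{n+1}\longrightarrow 2-\pi_0\quad\text{almost surely and in } L^1,$$ and, for every $j\ge 0$, $$\frac{\Delta_{n,j}}{n+\delta}\longrightarrow\frac{\pi_j}{2-\pi_0}\quad\text{almost surely.}$$ -/

import Mathlib

open Filter Topology MeasureTheory ProbabilityTheory
open scoped ENNReal

namespace StarVRRW

/-- A matrix indexed by a countably infinite set is stochastic: each row is a probability vector. -/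
structure IsStochastic (R : Matrix ℕ ℕ ℝ) : Prop where
  nonneg : ∀ i j, 0 ≤ R i j
  row_sum : ∀ i, HasSum (fun j => R i j) 1

/-- The `n`-step transition matrix `R ^ n` (product of infinite matrices). -/
noncomputable def nStep (R : Matrix ℕ ℕ ℝ) : ℕ → Matrix ℕ ℕ ℝ
  | 0 => 1
  | n + 1 => fun i j => ∑' k, nStep R n i k * R k j

/-- Aperiodicity: for every state `i`, the greatest common divisor of
`{n ≥ 1 | (R ^ n) i i > 0}` is `1`. -/
def IsAperiodic (R : Matrix ℕ ℕ ℝ) : Prop :=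
  ∀ i d : ℕ, (∀ n : ℕ, 1 ≤ n → 0 < nStep R n i i → d ∣ n) → d = 1

/-- `π` is a probability vector with `π R = π`. -/
structure IsStationaryDistribution (R : Matrix ℕ ℕ ℝ) (π : ℕ → ℝ) : Prop where
  nonneg : ∀ i, 0 ≤ π i
  sum_eq_one : HasSum π 1
  invariant : ∀ j, HasSum (fun i => π i * R i j) (π j)

/-- Uniform ergodicity: there is a stationary distribution `π`, and `R ^ n` converges to it
at a geometric rate, uniformly over all pairs of states. -/
def IsUniformlyErgodic (R : Matrix ℕ ℕ ℝ) : Prop :=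
  ∃ π : ℕ → ℝ, IsStationaryDistribution R π ∧
    ∃ C ρ : ℝ, 0 < C ∧ 0 < ρ ∧ ρ < 1 ∧
      ∀ n : ℕ, 1 ≤ n → ∀ u v : ℕ, |nStep R n u v - π v| ≤ C * ρ ^ n

/-- The vertices of the star are `v_0` (the root), `v_1`, `v_2`, …, encoded by their indices, and
`x` is the trajectory of the walker. `weight δ α x n j` is the weight of `v_j` at time `n`:
it starts at `δ j`, and whenever the walker takes an edge `(v_i, v_0)` (`i = 0` allowed: the loop)
the weights are increased by the row `α i`. -/
def weight (δ : ℕ → ℝ) (α : Matrix ℕ ℕ ℝ) (x : ℕ → ℕ) : ℕ → ℕ → ℝ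
  | 0, j => δ j
  | n + 1, j => weight δ α x n j + if x (n + 1) = 0 then α (x n) j else 0

/-- The `k`-th update time of the weights along the trajectory `x`, with the convention that the
zeroth one is `0`: the weights are updated at the times `m ≥ 1` with `x m = 0`. -/
noncomputable def updateTime (x : ℕ → ℕ) : ℕ → ℕ
  | 0 => 0
  | k + 1 => sInf {m : ℕ | updateTime x k < m ∧ x m = 0}

/-- `X` is the vertex-reinforced random walk on the infinite star graph with a loop at the root,
with initial weights `δ` and reinforcement matrix `α`: it starts at the root, and given its past
up to time `n`, it jumps from the root to `v_j` with probability proportional to the current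
weight of `v_j`, and from every other vertex back to the root. -/
structure IsWalk {Ω : Type*} [MeasurableSpace Ω] (P : Measure Ω)
    (δ : ℕ → ℝ) (α : Matrix ℕ ℕ ℝ) (X : ℕ → Ω → ℕ) : Prop where
  measurable : ∀ n, Measurable (X n)
  start : ∀ᵐ ω ∂P, X 0 ω = 0
  transition : ∀ n j : ℕ,
    P[(X (n + 1) ⁻¹' {j}).indicator (fun _ => (1 : ℝ)) |
        Filtration.natural X (fun m => (measurable m).stronglyMeasurable) n]
      =ᵐ[P] fun ω =>
        if X n ω = 0 then
          weight δ α (fun m => X m ω) n j / ∑' k, weight δ α (fun m => X m ω) n k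
        else if j = 0 then 1 else 0

end StarVRRW

/-! Average the weight vector against the column `j` of `α ^ N`, divide by the total weight, and
subtract `π j`: this is `deviation` at level `N`. When the walk returns to the root from `v_i`, the
unnormalized average grows by the entry `(i, j)` of `α ^ (N + 1)`. Returns from `v_i` match
departures to `v_i`, up to at most one pending departure (`sum_arrivals`), and given the past the
mean of that entry at a departure is the normalized average at level `N + 1`. So, up to a martingale
that is `o(n)` and bounded terms, the deviation at level `N` is a time average of the deviation at
level `N + 1` (`weightMean_sub`), and its asymptotic size is no larger
(`eventually_abs_deviation_le`).

At level `N` the deviation is a convex combination of the entries `nStep α N u j - π j`, hence at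
most `C * ρ ^ N` at all times. Descending from level `N` to level `0` and letting `N` grow shows
that the proportion of weight at `v_j` tends to `π j` (`tendsto_deviation`).

The loop is therefore taken at an asymptotic proportion `π 0` of the visits to the root. A loop
costs one unit of time and an excursion to a leaf two, so a visit costs `2 - π 0` on average
(`tendsto_visits`). This gives the update times, and the weights since the total weight grows by one
per update. The convergence in `L^1` follows by domination. -/

namespace StarVRRW

/-! ### Infinite stochastic matrices, their powers and the stationary distribution. -/

section Matrices

variable {p b : ℕ → ℝ} {A R : Matrix ℕ ℕ ℝ}

lemma IsStochastic.le_one (hA : IsStochastic A) (i j : ℕ) : A i j ≤ 1 :=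
  le_hasSum (hA.row_sum i) j fun k _ => hA.nonneg i k

lemma IsStochastic.summable_prod (hA : IsStochastic A) (hp : ∀ i, 0 ≤ p i) (hps : Summable p) :
    Summable fun z : ℕ × ℕ => p z.1 * A z.1 z.2 := by
  have h0 : 0 ≤ fun z : ℕ × ℕ => p z.1 * A z.1 z.2 :=
    Pi.le_def.mpr fun z => mul_nonneg (hp z.1) (hA.nonneg z.1 z.2)
  have h1 : ∀ i, Summable fun j => p i * A i j := fun i => (hA.row_sum i).summable.mul_left _
  have h2 : Summable fun i => ∑' j, p i * A i j := by
    simpa only [tsum_mul_left, (hA.row_sum _).tsum_eq, mul_one] using hps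
  exact (summable_prod_of_nonneg h0).mpr ⟨h1, h2⟩

lemma IsStochastic.hasSum_vecMul (hA : IsStochastic A) (hp : ∀ i, 0 ≤ p i) (hps : Summable p) :
    HasSum (fun j => ∑' i, p i * A i j) (∑' i, p i) := by
  have h := hA.summable_prod hp hps
  have h' : HasSum (fun z : ℕ × ℕ => p z.2 * A z.2 z.1) (∑' i, p i) := by
    have := h.hasSum
    rw [h.tsum_prod] at this
    simp only [tsum_mul_left, (hA.row_sum _).tsum_eq, mul_one] at this
    exact (Equiv.prodComm ℕ ℕ).hasSum_iff.mpr this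
  exact h'.prod_fiberwise fun j => (h'.summable.prod_factor j).hasSum

/-- Associativity of the product `p A b`: since `b` is bounded, the double series converges
absolutely and can be reordered. -/
lemma IsStochastic.tsum_vecMul_mul (hA : IsStochastic A) (hp : ∀ i, 0 ≤ p i) (hps : Summable p)
    (hb : ∀ i, 0 ≤ b i) (hb1 : ∀ i, b i ≤ 1) :
    ∑' k, (∑' i, p i * A i k) * b k = ∑' i, p i * ∑' k, A i k * b k := by
  have h : Summable fun z : ℕ × ℕ => p z.1 * A z.1 z.2 * b z.2 :=
    Summable.of_nonneg_of_le
      (fun z => mul_nonneg (mul_nonneg (hp _) (hA.nonneg _ _)) (hb _))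
      (fun z => mul_le_of_le_one_right (mul_nonneg (hp _) (hA.nonneg _ _)) (hb1 _))
      (hA.summable_prod hp hps)
  have hc := Summable.tsum_comm (f := fun i k => p i * A i k * b k) h
  simp_rw [← tsum_mul_right, hc, ← tsum_mul_left, mul_assoc]

lemma IsStochastic.nStep (hR : IsStochastic R) (n : ℕ) : IsStochastic (nStep R n) := by
  induction n with
  | zero =>
    refine ⟨fun i j => ?_, fun i => ?_⟩
    · simp only [StarVRRW.nStep, Matrix.one_apply]
      split_ifs <;> norm_num
    · have := hasSum_ite_eq i (1 : ℝ)
      simpa only [StarVRRW.nStep, Matrix.one_apply, eq_comm] using this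
  | succ n ih =>
    refine ⟨fun i j => tsum_nonneg fun k => mul_nonneg (ih.nonneg _ _) (hR.nonneg _ _),
      fun i => ?_⟩
    have := hR.hasSum_vecMul (ih.nonneg i) (ih.row_sum i).summable
    rwa [(ih.row_sum i).tsum_eq] at this

/-- `nStep` is defined by multiplication on the right; adding a row of `α` to the weights calls for
multiplication on the left. -/
lemma IsStochastic.tsum_mul_nStep (hR : IsStochastic R) (n i j : ℕ) :
    ∑' k, R i k * StarVRRW.nStep R n k j = StarVRRW.nStep R (n + 1) i j := by
  induction n generalizing j with
  | zero =>
    simp only [StarVRRW.nStep, Matrix.one_apply]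
    rw [tsum_eq_single j (by intro k hk; simp [hk]),
      tsum_eq_single i (by intro k hk; simp [hk.symm])]
    simp
  | succ n ih =>
    have h := (hR.nStep n).tsum_vecMul_mul (b := fun k => R k j) (hR.nonneg i)
      (hR.row_sum i).summable (fun k => hR.nonneg _ _) (fun k => hR.le_one _ _)
    simp only [ih] at h
    exact h.symm

lemma IsStationaryDistribution.tsum_mul_nStep {π : ℕ → ℝ} (hR : IsStochastic R)
    (hπ : IsStationaryDistribution R π) (n j : ℕ) :
    ∑' i, π i * StarVRRW.nStep R n i j = π j := by
  induction n generalizing j with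
  | zero =>
    simp only [StarVRRW.nStep, Matrix.one_apply]
    rw [tsum_eq_single j (by intro k hk; simp [hk])]
    simp
  | succ n ih =>
    have h := (hR.nStep n).tsum_vecMul_mul (b := fun k => R k j) hπ.nonneg
      hπ.sum_eq_one.summable (fun k => hR.nonneg _ _) (fun k => hR.le_one _ _)
    simp only [ih, (hπ.invariant j).tsum_eq] at h
    exact h.symm

lemma abs_tsum_mul_sub_le {p h : ℕ → ℝ} {a c ε : ℝ} (hp : ∀ i, 0 ≤ p i) (hps : HasSum p a)
    (hh : ∀ i, |h i - c| ≤ ε) : |∑' i, p i * h i - c * a| ≤ ε * a := by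
  have hs : Summable fun i => p i * (h i - c) :=
    Summable.of_norm_bounded (hps.summable.mul_left ε) fun i => by
      rw [Real.norm_eq_abs, abs_mul, abs_of_nonneg (hp i), mul_comm]
      exact mul_le_mul_of_nonneg_right (hh i) (hp i)
  have h1 : ∑' i, p i * h i - c * a = ∑' i, p i * (h i - c) := by
    have : HasSum (fun i => p i * h i) (∑' i, p i * (h i - c) + c * a) := by
      convert hs.hasSum.add (hps.mul_left c) using 1
      ext i; ring
    rw [this.tsum_eq]; ring
  rw [h1, ← Real.norm_eq_abs]
  refine tsum_of_norm_bounded (hps.mul_left ε) fun i => ?_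
  rw [Real.norm_eq_abs, abs_mul, abs_of_nonneg (hp i), mul_comm]
  exact mul_le_mul_of_nonneg_right (hh i) (hp i)

/-- The stationary distribution of a uniformly ergodic matrix is unique, so that the geometric
rate holds for any given stationary distribution. -/
lemma IsStationaryDistribution.rate {π : ℕ → ℝ} (hR : IsStochastic R)
    (hπ : IsStationaryDistribution R π) (hE : IsUniformlyErgodic R) :
    ∃ C ρ : ℝ, 0 < C ∧ 0 < ρ ∧ ρ < 1 ∧
      ∀ n : ℕ, 1 ≤ n → ∀ u v : ℕ, |StarVRRW.nStep R n u v - π v| ≤ C * ρ ^ n := by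
  obtain ⟨π', -, C, ρ, hC, hρ, hρ1, h⟩ := hE
  have hlim : Tendsto (fun n : ℕ => C * ρ ^ n) atTop (𝓝 0) := by
    simpa using (tendsto_pow_atTop_nhds_zero_of_lt_one hρ.le hρ1).const_mul C
  have heq : π' = π := by
    funext v
    -- By invariance, `π v` is the `π`-average over `u` of the entries `(u, v)` of `R ^ n`, all of
    -- which are close to `π' v`.
    have hle : ∀ᶠ n : ℕ in atTop, |π v - π' v| ≤ C * ρ ^ n := by
      filter_upwards [eventually_ge_atTop 1] with n hn
      have := abs_tsum_mul_sub_le hπ.nonneg hπ.sum_eq_one (fun i => h n hn i v)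
      simpa [hπ.tsum_mul_nStep hR] using this
    have := ge_of_tendsto hlim hle
    have := abs_nonpos_iff.mp this
    linarith
  exact ⟨C, ρ, hC, hρ, hρ1, heq ▸ h⟩

end Matrices

/-! ### Deterministic analysis of a single trajectory. -/

section Paths

/-- A trajectory that starts at the root and returns to it right after each visit to a leaf. -/
structure IsStarPath (x : ℕ → ℕ) : Prop where
  start : x 0 = 0
  step : ∀ n, x n ≠ 0 → x (n + 1) = 0

/-- The indicator of the walker being at the root at time `n`. -/
noncomputable def atRoot (x : ℕ → ℕ) (n : ℕ) : ℝ := if x n = 0 then 1 else 0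

/-- The number of visits to the root before time `n`. -/
noncomputable def visits (x : ℕ → ℕ) (n : ℕ) : ℝ := ∑ i ∈ Finset.range n, atRoot x i

/-- The total weight at time `n`. -/
noncomputable def total (δ : ℕ → ℝ) (x : ℕ → ℕ) (n : ℕ) : ℝ :=
  ∑' i, δ i + ∑ i ∈ Finset.range n, atRoot x (i + 1)

/-- The probability of a jump to `v_j` after the time `n` along the trajectory `x`. -/
noncomputable def jump (δ : ℕ → ℝ) (α : Matrix ℕ ℕ ℝ) (x : ℕ → ℕ) (n j : ℕ) : ℝ :=
  if x n = 0 then weight δ α x n j / ∑' k, weight δ α x n k else if j = 0 then 1 else 0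

/-- The difference between the value of `h` at the next vertex and its mean given the past. -/
noncomputable def innovation (δ : ℕ → ℝ) (α : Matrix ℕ ℕ ℝ) (x : ℕ → ℕ) (h : ℕ → ℝ) (n : ℕ) : ℝ :=
  h (x (n + 1)) - ∑' k, jump δ α x n k * h k

variable {x : ℕ → ℕ} {δ : ℕ → ℝ} {α : Matrix ℕ ℕ ℝ}

lemma atRoot_nonneg (x : ℕ → ℕ) (n : ℕ) : 0 ≤ atRoot x n := by
  unfold atRoot; split_ifs <;> norm_num

lemma atRoot_le_one (x : ℕ → ℕ) (n : ℕ) : atRoot x n ≤ 1 := by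
  unfold atRoot; split_ifs <;> norm_num

lemma visits_succ (x : ℕ → ℕ) (n : ℕ) : visits x (n + 1) = visits x n + atRoot x n :=
  Finset.sum_range_succ _ _

lemma total_succ (δ : ℕ → ℝ) (x : ℕ → ℕ) (n : ℕ) :
    total δ x (n + 1) = total δ x n + atRoot x (n + 1) := by
  simp only [total, Finset.sum_range_succ, add_assoc]

lemma weight_succ (δ : ℕ → ℝ) (α : Matrix ℕ ℕ ℝ) (x : ℕ → ℕ) (n j : ℕ) :
    weight δ α x (n + 1) j = weight δ α x n j + atRoot x (n + 1) * α (x n) j := by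
  simp only [weight, atRoot, ite_mul, one_mul, zero_mul]

lemma weight_nonneg (hδ : ∀ i, 0 ≤ δ i) (hα : IsStochastic α) (x : ℕ → ℕ) (n j : ℕ) :
    0 ≤ weight δ α x n j := by
  induction n with
  | zero => exact hδ j
  | succ n ih =>
    rw [weight_succ]
    exact add_nonneg ih (mul_nonneg (atRoot_nonneg _ _) (hα.nonneg _ _))

lemma hasSum_weight (hδs : Summable δ) (hα : IsStochastic α) (x : ℕ → ℕ) (n : ℕ) :
    HasSum (weight δ α x n) (total δ x n) := by
  induction n with
  | zero =>
    have : HasSum (weight δ α x 0) (∑' i, δ i) := hδs.hasSum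
    simpa [total] using this
  | succ n ih =>
    rw [total_succ]
    have := ih.add ((hα.row_sum (x n)).mul_left (atRoot x (n + 1)))
    rw [mul_one] at this
    exact this.congr_fun fun j => weight_succ _ _ _ _ _

lemma tsum_le_total (δ : ℕ → ℝ) (x : ℕ → ℕ) (n : ℕ) : ∑' i, δ i ≤ total δ x n :=
  le_add_of_nonneg_right (Finset.sum_nonneg fun _ _ => atRoot_nonneg _ _)

lemma jump_nonneg (hδ : ∀ i, 0 ≤ δ i) (hα : IsStochastic α) (x : ℕ → ℕ) (n j : ℕ) :
    0 ≤ jump δ α x n j := by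
  unfold jump
  split_ifs
  · exact div_nonneg (weight_nonneg hδ hα _ _ _)
      (tsum_nonneg fun k => weight_nonneg hδ hα _ _ _)
  · norm_num
  · norm_num

lemma hasSum_jump (hδs : Summable δ) (hδ0 : 0 < ∑' i, δ i) (hα : IsStochastic α)
    (x : ℕ → ℕ) (n : ℕ) : HasSum (jump δ α x n) 1 := by
  by_cases h : x n = 0
  · have hw := hasSum_weight hδs hα x n
    have h0 : total δ x n ≠ 0 := (hδ0.trans_le (tsum_le_total δ x n)).ne'
    have := hw.div_const (total δ x n)
    rw [div_self h0] at this
    refine this.congr_fun fun j => ?_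
    simp [jump, h, hw.tsum_eq]
  · refine (hasSum_ite_eq 0 (1 : ℝ)).congr_fun fun j => ?_
    simp [jump, h]

/-- The weights averaged against the column `j` of `α ^ N`. -/
noncomputable def weightMean (δ : ℕ → ℝ) (α : Matrix ℕ ℕ ℝ) (x : ℕ → ℕ) (j N n : ℕ) : ℝ :=
  ∑' u, weight δ α x n u * nStep α N u j

/-- The deviation of the normalized average of the weights against the column `j` of `α ^ N`. -/
noncomputable def deviation (δ : ℕ → ℝ) (α : Matrix ℕ ℕ ℝ) (π : ℕ → ℝ) (x : ℕ → ℕ)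
    (j N n : ℕ) : ℝ :=
  weightMean δ α x j N n / total δ x n - π j

lemma weightMean_zero (δ : ℕ → ℝ) (α : Matrix ℕ ℕ ℝ) (x : ℕ → ℕ) (j n : ℕ) :
    weightMean δ α x j 0 n = weight δ α x n j := by
  simp only [weightMean, nStep, Matrix.one_apply]
  rw [tsum_eq_single j (by intro k hk; simp [hk])]
  simp

lemma weightMean_succ (hδ : ∀ i, 0 ≤ δ i) (hδs : Summable δ) (hα : IsStochastic α)
    (x : ℕ → ℕ) (j N n : ℕ) :
    weightMean δ α x j N (n + 1) =
      weightMean δ α x j N n + atRoot x (n + 1) * nStep α (N + 1) (x n) j := by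
  have hN := hα.nStep N
  have hs : ∀ {p : ℕ → ℝ}, (∀ i, 0 ≤ p i) → Summable p →
      Summable fun u => p u * nStep α N u j := fun hp hps =>
    Summable.of_nonneg_of_le (fun u => mul_nonneg (hp u) (hN.nonneg _ _))
      (fun u => mul_le_of_le_one_right (hp u) (hN.le_one _ _)) hps
  have h1 := hs (weight_nonneg hδ hα x n) (hasSum_weight hδs hα x n).summable
  have h2 := hs (hα.nonneg (x n)) (hα.row_sum (x n)).summable
  rw [← hα.tsum_mul_nStep, ← tsum_mul_left, weightMean, weightMean,
    ← h1.tsum_add (h2.mul_left _)]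
  refine tsum_congr fun u => ?_
  rw [weight_succ]; ring

/-- The normalized weights form a probability vector, so the bound is uniform in the time and in the
trajectory. -/
lemma abs_deviation_le (hδ : ∀ i, 0 ≤ δ i) (hδs : Summable δ) (hδ0 : 0 < ∑' i, δ i)
    (hα : IsStochastic α) {π : ℕ → ℝ} (x : ℕ → ℕ) {j N : ℕ} {ε : ℝ}
    (hε : ∀ u, |nStep α N u j - π j| ≤ ε) (n : ℕ) : |deviation δ α π x j N n| ≤ ε := by
  have hT : 0 < total δ x n := hδ0.trans_le (tsum_le_total δ x n)
  have h := abs_tsum_mul_sub_le (weight_nonneg hδ hα x n) (hasSum_weight hδs hα x n) hε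
  rw [deviation, div_sub' hT.ne', abs_div, abs_of_pos hT, div_le_iff₀ hT, mul_comm (total δ x n)]
  exact h

namespace IsStarPath

variable (hx : IsStarPath x)
include hx

/-- The total weight counts root times in `1, …, n`, while `visits` counts them in `0, …, n - 1`. -/
lemma total_eq_visits (n : ℕ) :
    total δ x n = ∑' i, δ i + visits x n - (1 - atRoot x n) := by
  induction n with
  | zero => simp [total, visits, atRoot, hx.start]
  | succ n ih => rw [total_succ, ih, visits_succ]; ring

lemma half_le_visits (n : ℕ) : (n : ℝ) ≤ 2 * visits x n - (1 - atRoot x n) := by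
  induction n with
  | zero => simp [visits, atRoot, hx.start]
  | succ n ih =>
    rw [visits_succ]
    push_cast
    by_cases h : x n = 0
    · have : atRoot x n = 1 := by simp [atRoot, h]
      have := atRoot_nonneg x (n + 1)
      linarith
    · have : atRoot x n = 0 := by simp [atRoot, h]
      have : atRoot x (n + 1) = 1 := by simp [atRoot, hx.step n h]
      linarith

/-- Arrivals at the root from `v_i` and departures from the root to `v_i` balance. -/
lemma sum_arrivals (f : ℕ → ℝ) (n : ℕ) :
    ∑ i ∈ Finset.range n, atRoot x (i + 1) * f (x i) =
      ∑ i ∈ Finset.range n, atRoot x i * f (x (i + 1)) - (1 - atRoot x n) * f (x n) := by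
  induction n with
  | zero => simp [atRoot, hx.start]
  | succ n ih =>
    rw [Finset.sum_range_succ, Finset.sum_range_succ, ih]
    by_cases h : x n = 0
    · by_cases h' : x (n + 1) = 0 <;> simp [atRoot, h, h']
    · simp [atRoot, h, hx.step n h]

/-- At the root the conditional mean is the normalized `weightMean`. At a leaf the next vertex is
certain and both sides vanish. -/
lemma innovation_eq (hδs : Summable δ) (hα : IsStochastic α)
    (π : ℕ → ℝ) (j N n : ℕ) :
    innovation δ α x (fun u => nStep α N u j) n =
      atRoot x n * (nStep α N (x (n + 1)) j - π j) - atRoot x n * deviation δ α π x j N n := by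
  by_cases h : x n = 0
  · have : ∑' k, jump δ α x n k * nStep α N k j = weightMean δ α x j N n / total δ x n := by
      rw [weightMean, ← tsum_div_const]
      refine tsum_congr fun k => ?_
      rw [jump, if_pos h, (hasSum_weight hδs hα x n).tsum_eq]
      ring
    simp only [innovation, this, atRoot, h, if_true, deviation]
    ring
  · have : ∑' k, jump δ α x n k * nStep α N k j = nStep α N 0 j := by
      rw [tsum_eq_single 0 (by intro k hk; simp [jump, h, hk])]
      simp [jump, h]
    simp [innovation, this, atRoot, h, hx.step n h]

/-- The exact identity linking level `N` to level `N + 1`: initial value, martingale, accumulated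
deviation, and the departure still pending when `x n` is a leaf. -/
lemma weightMean_sub (hδ : ∀ i, 0 ≤ δ i) (hδs : Summable δ) (hα : IsStochastic α)
    (π : ℕ → ℝ) (j N n : ℕ) :
    weightMean δ α x j N n - π j * total δ x n =
      (weightMean δ α x j N 0 - π j * ∑' i, δ i)
        + (∑ i ∈ Finset.range n, innovation δ α x (fun u => nStep α (N + 1) u j) i
        + ∑ i ∈ Finset.range n, atRoot x i * deviation δ α π x j (N + 1) i)
        - (1 - atRoot x n) * (nStep α (N + 1) (x n) j - π j) := by
  have h1 : ∀ n, weightMean δ α x j N n - π j * total δ x n =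
      (weightMean δ α x j N 0 - π j * ∑' i, δ i) +
        ∑ i ∈ Finset.range n, atRoot x (i + 1) * (nStep α (N + 1) (x i) j - π j) := by
    intro n
    induction n with
    | zero => simp [total]
    | succ n ih =>
      rw [weightMean_succ hδ hδs hα, total_succ, Finset.sum_range_succ, ← add_assoc, ← ih]
      ring
  rw [h1, hx.sum_arrivals (fun u => nStep α (N + 1) u j - π j), ← Finset.sum_add_distrib,
    Finset.sum_congr rfl fun i _ => ?_, add_sub_assoc]
  rw [hx.innovation_eq hδs hα π]
  ring

end IsStarPath

/-- If the deviation for the column of `α ^ (N + 1)` is eventually at most `ε`, so is, up to an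
arbitrarily small error, the one for the column of `α ^ N`. -/
lemma IsStarPath.eventually_abs_deviation_le (hx : IsStarPath x)
    (hδ : ∀ i, 0 ≤ δ i) (hδs : Summable δ) (hδ0 : 0 < ∑' i, δ i) (hα : IsStochastic α)
    {π : ℕ → ℝ} (hπ : IsStationaryDistribution α π) {j N : ℕ} {ε ε' : ℝ}
    (hinn : Tendsto (fun n : ℕ => (∑ i ∈ Finset.range n,
      innovation δ α x (fun u => nStep α (N + 1) u j) i) / n) atTop (𝓝 0))
    (hdev : ∀ᶠ n in atTop, |deviation δ α π x j (N + 1) n| ≤ ε) (hε : ε < ε') :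
    ∀ᶠ n in atTop, |deviation δ α π x j N n| ≤ ε' := by
  have hε0 : 0 ≤ ε := by
    obtain ⟨n, hn⟩ := hdev.exists
    exact (abs_nonneg _).trans hn
  have hcol : ∀ u, |nStep α (N + 1) u j - π j| ≤ 1 := fun u => by
    have h1 := (hα.nStep (N + 1)).nonneg u j
    have h2 := (hα.nStep (N + 1)).le_one u j
    have h3 := hπ.nonneg j
    have h4 := le_hasSum hπ.sum_eq_one j fun k _ => hπ.nonneg k
    rw [abs_le]; constructor <;> linarith
  obtain ⟨M, hM⟩ := eventually_atTop.mp hdev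
  -- Each of the times before `M` contributes at most `1`, each later visit to the root at most `ε`.
  have hsum : ∀ n, |∑ i ∈ Finset.range n, atRoot x i * deviation δ α π x j (N + 1) i|
      ≤ M + ε * visits x n := by
    intro n
    rw [visits, Finset.mul_sum]
    have hMn : ∀ n, ∑ i ∈ Finset.range n, (if i < M then (1 : ℝ) else 0) ≤ M := fun n => by
      rw [← Finset.sum_filter, Finset.sum_const, nsmul_eq_mul, mul_one]
      have : Finset.filter (fun i => i < M) (Finset.range n) ⊆ Finset.range M := fun i hi => by
        simp at hi ⊢; exact hi.2
      exact_mod_cast (Finset.card_le_card this).trans (by simp)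
    refine (Finset.abs_sum_le_sum_abs _ _).trans
      (le_trans ?_ (add_le_add_left (hMn n) _))
    rw [← Finset.sum_add_distrib]
    refine Finset.sum_le_sum fun i _ => ?_
    rw [abs_mul, abs_of_nonneg (atRoot_nonneg x i)]
    have ha := atRoot_nonneg x i
    have ha1 := atRoot_le_one x i
    split_ifs with hi
    · have := abs_deviation_le hδ hδs hδ0 hα x hcol i
      nlinarith [abs_nonneg (deviation δ α π x j (N + 1) i)]
    · have := hM i (not_lt.mp hi)
      nlinarith [abs_nonneg (deviation δ α π x j (N + 1) i)]
  set E : ℕ → ℝ := fun n => ∑ i ∈ Finset.range n,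
    innovation δ α x (fun u => nStep α (N + 1) u j) i with hE
  -- All bounded errors: the initial value, `1` for the pending departure, `M` for the early times,
  -- and `ε` because the visits exceed the total weight by at most `1`.
  set B : ℝ := |weightMean δ α x j N 0 - π j * ∑' i, δ i| + 1 + M + ε with hB
  have hlim : Tendsto (fun n : ℕ => 4 * (B / n + |E n / n|)) atTop (𝓝 0) := by
    have h1 : Tendsto (fun n : ℕ => B / (n : ℝ)) atTop (𝓝 0) :=
      tendsto_const_div_atTop_nhds_zero_nat B
    have h2 := hinn.abs
    simpa using (h1.add h2).const_mul 4
  filter_upwards [hlim.eventually (gt_mem_nhds (sub_pos.mpr hε)), eventually_ge_atTop 4]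
    with n hn hn4
  have hn4' : (4 : ℝ) ≤ n := by exact_mod_cast hn4
  have hn0 : (0 : ℝ) < n := by linarith
  have hT : 0 < total δ x n := hδ0.trans_le (tsum_le_total δ x n)
  have hTv := hx.total_eq_visits (δ := δ) n
  have hv := hx.half_le_visits n
  have hr0 := atRoot_nonneg x n
  have hr1 := atRoot_le_one x n
  -- About half of the time at least is spent at the root; `1 / 4` leaves room for the boundary term
  -- and explains the factor `4` in `hlim`.
  have hTn : (n : ℝ) / 4 ≤ total δ x n := by linarith
  have hkey : |weightMean δ α x j N n - π j * total δ x n| ≤ B + |E n| + ε * total δ x n := by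
    rw [hx.weightMean_sub hδ hδs hα π j N n]
    have h3 : |(1 - atRoot x n) * (nStep α (N + 1) (x n) j - π j)| ≤ 1 := by
      rw [abs_mul, abs_of_nonneg (by linarith : 0 ≤ 1 - atRoot x n)]
      have := hcol (x n)
      nlinarith [abs_nonneg (nStep α (N + 1) (x n) j - π j)]
    have h4 := hsum n
    have h5 : ε * visits x n ≤ ε * total δ x n + ε := by nlinarith
    refine (abs_sub _ _).trans ?_
    have h6 := abs_add_le (weightMean δ α x j N 0 - π j * ∑' i, δ i)
      (E n + ∑ i ∈ Finset.range n, atRoot x i * deviation δ α π x j (N + 1) i)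
    have h7 := abs_add_le (E n)
      (∑ i ∈ Finset.range n, atRoot x i * deviation δ α π x j (N + 1) i)
    linarith
  rw [deviation, div_sub' hT.ne', abs_div, abs_of_pos hT, div_le_iff₀ hT, mul_comm (total δ x n)]
  have h8 : B + |E n| ≤ (ε' - ε) * total δ x n := by
    have h9 : B + |E n| = (4 * (B / n + |E n / n|)) * (n / 4) := by
      rw [abs_div, abs_of_pos hn0]; field_simp
    rw [h9]
    exact mul_le_mul hn.le hTn (by positivity) (by linarith)
  linarith

/-- Along a trajectory whose innovations average out, the normalized weights converge. -/
lemma IsStarPath.tendsto_deviation (hx : IsStarPath x)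
    (hδ : ∀ i, 0 ≤ δ i) (hδs : Summable δ) (hδ0 : 0 < ∑' i, δ i) (hα : IsStochastic α)
    (hαE : IsUniformlyErgodic α) {π : ℕ → ℝ} (hπ : IsStationaryDistribution α π) {j : ℕ}
    (hinn : ∀ N, Tendsto (fun n : ℕ => (∑ i ∈ Finset.range n,
      innovation δ α x (fun u => nStep α N u j) i) / n) atTop (𝓝 0)) :
    Tendsto (deviation δ α π x j 0) atTop (𝓝 0) := by
  obtain ⟨C, ρ, hC, hρ, hρ1, hrate⟩ := hπ.rate hα hαE
  -- Having every `ε > c` as an eventual bound says that the limsup is at most `c`. In this form the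
  -- arbitrarily small loss at each level does not accumulate.
  have hdown : ∀ N K : ℕ, ∀ c : ℝ,
      (∀ ε > c, ∀ᶠ n in atTop, |deviation δ α π x j (K + N) n| ≤ ε) →
      ∀ ε > c, ∀ᶠ n in atTop, |deviation δ α π x j K n| ≤ ε := by
    intro N
    induction N with
    | zero => exact fun K c h => h
    | succ N ih =>
      intro K c h
      refine ih K c fun ε hε => ?_
      obtain ⟨ε₁, h1, h2⟩ := exists_between hε
      exact hx.eventually_abs_deviation_le hδ hδs hδ0 hα hπ (hinn _) (h ε₁ h1) h2
  rw [Metric.tendsto_nhds]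
  intro ε hε
  have hlim : Tendsto (fun n : ℕ => C * ρ ^ n) atTop (𝓝 0) := by
    simpa using (tendsto_pow_atTop_nhds_zero_of_lt_one hρ.le hρ1).const_mul C
  obtain ⟨N, hN, hN1⟩ :=
    ((hlim.eventually (gt_mem_nhds hε)).and (eventually_ge_atTop 1)).exists
  obtain ⟨ε₁, h1, h2⟩ := exists_between hN
  have := hdown N 0 (C * ρ ^ N) (fun ε' hε' => Eventually.of_forall fun n => by
    rw [zero_add]
    exact (abs_deviation_le hδ hδs hδ0 hα x (fun u => hrate N hN1 u j) n).trans hε'.le) ε₁ h1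
  filter_upwards [this] with n hn
  rw [Real.dist_eq, sub_zero]
  exact hn.trans_lt h2

/-- The proportion of time spent at the root. -/
lemma IsStarPath.tendsto_visits (hx : IsStarPath x)
    (hδs : Summable δ) (hα : IsStochastic α) {π : ℕ → ℝ}
    (hdev : Tendsto (deviation δ α π x 0 0) atTop (𝓝 0))
    (hinn : Tendsto (fun n : ℕ => (∑ i ∈ Finset.range n,
      innovation δ α x (fun u => nStep α 0 u 0) i) / n) atTop (𝓝 0)) :
    Tendsto (fun n : ℕ => (2 - π 0) * (visits x n / n)) atTop (𝓝 1) := by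
  -- `nStep α 0 u 0` is the indicator of `u = 0`, so the last two sums together count the loops
  -- minus `π 0` per visit. The identity says that elapsed time is twice the visits minus the loops,
  -- up to an unfinished excursion.
  have hid : ∀ n : ℕ, (2 - π 0) * visits x n = n + (1 - atRoot x n) +
      (∑ i ∈ Finset.range n, innovation δ α x (fun u => nStep α 0 u 0) i +
        ∑ i ∈ Finset.range n, atRoot x i * deviation δ α π x 0 0 i) := by
    intro n
    rw [← Finset.sum_add_distrib]
    simp only [hx.innovation_eq hδs hα π, sub_add_cancel]
    induction n with
    | zero => simp [visits, atRoot, hx.start]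
    | succ n ih =>
      rw [visits_succ, mul_add, ih, Finset.sum_range_succ]
      by_cases h : x n = 0
      · by_cases h' : x (n + 1) = 0 <;> simp [atRoot, h, h', nStep, Matrix.one_apply] <;> ring
      · simp [atRoot, h, hx.step n h]
  have hces : Tendsto (fun n : ℕ => (∑ i ∈ Finset.range n,
      atRoot x i * deviation δ α π x 0 0 i) / n) atTop (𝓝 0) := by
    have : Tendsto (fun i => atRoot x i * deviation δ α π x 0 0 i) atTop (𝓝 0) := by
      refine squeeze_zero_norm (fun i => ?_) (by simpa using hdev.abs)
      rw [Real.norm_eq_abs, abs_mul, abs_of_nonneg (atRoot_nonneg x i)]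
      exact mul_le_of_le_one_left (abs_nonneg _) (atRoot_le_one x i)
    refine this.cesaro.congr fun n => ?_
    rw [div_eq_inv_mul]
  have hb : Tendsto (fun n : ℕ => (1 - atRoot x n) / n) atTop (𝓝 0) := by
    refine squeeze_zero (fun n => div_nonneg (by linarith [atRoot_le_one x n]) (by positivity))
      (fun n => ?_) (tendsto_const_div_atTop_nhds_zero_nat 1)
    gcongr
    linarith [atRoot_nonneg x n]
  have hlim : Tendsto (fun n : ℕ => 1 + (1 - atRoot x n) / n +
      ((∑ i ∈ Finset.range n, innovation δ α x (fun u => nStep α 0 u 0) i) / n +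
        (∑ i ∈ Finset.range n, atRoot x i * deviation δ α π x 0 0 i) / n)) atTop (𝓝 1) := by
    simpa using (tendsto_const_nhds.add hb).add (hinn.add hces)
  refine hlim.congr' ?_
  filter_upwards [eventually_ge_atTop 1] with n hn
  have hn0 : (n : ℝ) ≠ 0 := by positivity
  rw [← mul_div_assoc, hid]
  field_simp

lemma IsStationaryDistribution.two_sub_pos {π : ℕ → ℝ} (hπ : IsStationaryDistribution α π) :
    0 < 2 - π 0 := by
  have := le_hasSum hπ.sum_eq_one 0 fun k _ => hπ.nonneg k
  linarith

lemma IsStarPath.tendsto_weight (hx : IsStarPath x) (hδ0 : 0 < ∑' i, δ i)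
    {π : ℕ → ℝ} (hπ : IsStationaryDistribution α π) {j : ℕ}
    (hdev : Tendsto (deviation δ α π x j 0) atTop (𝓝 0))
    (hvis : Tendsto (fun n : ℕ => (2 - π 0) * (visits x n / n)) atTop (𝓝 1)) :
    Tendsto (fun n : ℕ => weight δ α x n j / ((n : ℝ) + ∑' i, δ i)) atTop
      (𝓝 (π j / (2 - π 0))) := by
  set D := ∑' i, δ i with hD
  have hpos := hπ.two_sub_pos
  have h1 : Tendsto (fun n : ℕ => weight δ α x n j / total δ x n) atTop (𝓝 (π j)) := by
    have := hdev.add_const (π j)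
    rw [zero_add] at this
    refine this.congr fun n => ?_
    rw [deviation, weightMean_zero, sub_add_cancel]
  have h2 : Tendsto (fun n : ℕ => visits x n / n) atTop (𝓝 (2 - π 0)⁻¹) := by
    have := hvis.const_mul (2 - π 0)⁻¹
    rw [mul_one] at this
    refine this.congr fun n => ?_
    rw [inv_mul_cancel_left₀ hpos.ne']
  have hnat : Tendsto (fun n : ℕ => (n : ℝ) / (n + D)) atTop (𝓝 1) :=
    tendsto_natCast_div_add_atTop D
  have hinv : Tendsto (fun n : ℕ => ((n : ℝ) + D)⁻¹) atTop (𝓝 0) :=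
    (tendsto_atTop_add_const_right _ _ tendsto_natCast_atTop_atTop).inv_tendsto_atTop
  have hb : Tendsto (fun n : ℕ => (D - (1 - atRoot x n)) * ((n : ℝ) + D)⁻¹) atTop (𝓝 0) := by
    refine squeeze_zero_norm (a := fun n : ℕ => (D + 1) * ((n : ℝ) + D)⁻¹) (fun n => ?_)
      (by simpa using hinv.const_mul (D + 1))
    have hp : 0 < ((n : ℝ) + D)⁻¹ := by positivity
    rw [norm_mul, Real.norm_of_nonneg hp.le]
    refine mul_le_mul_of_nonneg_right ?_ hp.le
    rw [Real.norm_eq_abs, abs_le]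
    constructor <;> linarith [atRoot_nonneg x n, atRoot_le_one x n]
  have h3 : Tendsto (fun n : ℕ => total δ x n / ((n : ℝ) + D)) atTop (𝓝 (2 - π 0)⁻¹) := by
    have := (h2.mul hnat).add hb
    rw [mul_one, add_zero] at this
    refine this.congr' ?_
    filter_upwards [eventually_ge_atTop 1] with n hn
    have hn0 : (n : ℝ) ≠ 0 := by positivity
    have hnD : (n : ℝ) + D ≠ 0 := by positivity
    rw [hx.total_eq_visits]
    field_simp
    ring
  rw [div_eq_mul_inv]
  refine (h1.mul h3).congr fun n => ?_
  have hT : total δ x n ≠ 0 := (hδ0.trans_le (tsum_le_total δ x n)).ne'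
  field_simp

end Paths

/-! ### Update times as successive visits to the root. -/

section UpdateTimes

variable {x : ℕ → ℕ}

/-- The time of the next visit to the root after the time `s`, if `x` is a path on the star. -/
def nextVisit (x : ℕ → ℕ) (s : ℕ) : ℕ := if x (s + 1) = 0 then s + 1 else s + 2

lemma IsStarPath.updateTime_succ (hx : IsStarPath x) (k : ℕ) :
    updateTime x (k + 1) = nextVisit x (updateTime x k) := by
  set s := updateTime x k with hs
  have hdef : updateTime x (k + 1) = sInf {m : ℕ | s < m ∧ x m = 0} := rfl
  rw [hdef, nextVisit]
  split_ifs with h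
  · exact IsLeast.csInf_eq ⟨⟨by lia, h⟩, fun m hm => hm.1⟩
  · refine IsLeast.csInf_eq ⟨⟨by lia, hx.step _ h⟩, fun m hm => ?_⟩
    obtain ⟨h1, h2⟩ := hm
    by_contra h3
    have : m = s + 1 := by lia
    exact h (this ▸ h2)

lemma IsStarPath.apply_updateTime (hx : IsStarPath x) (k : ℕ) : x (updateTime x k) = 0 := by
  cases k with
  | zero => exact hx.start
  | succ k =>
    rw [hx.updateTime_succ, nextVisit]
    split_ifs with h
    · exact h
    · exact hx.step _ h

lemma IsStarPath.visits_updateTime (hx : IsStarPath x) (k : ℕ) :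
    visits x (updateTime x k) = k := by
  induction k with
  | zero => simp [visits, updateTime]
  | succ k ih =>
    have h0 := hx.apply_updateTime k
    rw [hx.updateTime_succ, nextVisit]
    split_ifs with h
    · rw [visits_succ, ih]; simp [atRoot, h0]
    · rw [visits_succ, visits_succ, ih]; simp [atRoot, h0, h]

lemma IsStarPath.updateTime_le (hx : IsStarPath x) (k : ℕ) : updateTime x k ≤ 2 * k := by
  induction k with
  | zero => simp [updateTime]
  | succ k ih =>
    rw [hx.updateTime_succ, nextVisit]
    split_ifs <;> lia

lemma IsStarPath.le_updateTime (hx : IsStarPath x) (k : ℕ) : k ≤ updateTime x k := by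
  induction k with
  | zero => simp
  | succ k ih =>
    rw [hx.updateTime_succ, nextVisit]
    split_ifs <;> lia

/-- Evaluating the asymptotics of `visits` along the update times, where `visits` equals the index,
inverts them. -/
lemma IsStarPath.tendsto_updateTime (hx : IsStarPath x) {c : ℝ}
    (hvis : Tendsto (fun n : ℕ => c * (visits x n / n)) atTop (𝓝 1)) :
    Tendsto (fun n : ℕ => (updateTime x n : ℝ) / ((n : ℝ) + 1)) atTop (𝓝 c) := by
  have hσ : Tendsto (updateTime x) atTop atTop :=
    tendsto_atTop_mono hx.le_updateTime tendsto_id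
  have h1 := ((hvis.comp hσ).inv₀ one_ne_zero).mul (tendsto_natCast_div_add_atTop (1 : ℝ))
  have h2 := h1.const_mul c
  rw [inv_one, mul_one, mul_one] at h2
  refine h2.congr' ?_
  have hc : c ≠ 0 := by
    rintro rfl
    simp only [zero_mul] at hvis
    exact zero_ne_one (tendsto_nhds_unique tendsto_const_nhds hvis)
  filter_upwards [eventually_ge_atTop 1] with n hn
  have hn0 : (n : ℝ) ≠ 0 := by positivity
  simp only [Function.comp, hx.visits_updateTime]
  field_simp

/-- The update times of a path on the star, as a recursion. -/
def visitTime (x : ℕ → ℕ) : ℕ → ℕ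
  | 0 => 0
  | k + 1 => nextVisit x (visitTime x k)

lemma IsStarPath.updateTime_eq (hx : IsStarPath x) (k : ℕ) : updateTime x k = visitTime x k := by
  induction k with
  | zero => rfl
  | succ k ih => rw [hx.updateTime_succ, ih, visitTime]

end UpdateTimes

/-! ### Martingale law of large numbers. -/

section Probability

variable {Ω : Type*} [mΩ : MeasurableSpace Ω] {P : Measure Ω}

/-- A strong law of large numbers for bounded martingale differences. -/
lemma ae_tendsto_average_of_condExp_eq_zero [IsProbabilityMeasure P] {ℱ : Filtration ℕ mΩ}
    {D : ℕ → Ω → ℝ} {c : ℝ} (hD : ∀ n, StronglyMeasurable[ℱ (n + 1)] (D n))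
    (hc : ∀ n ω, |D n ω| ≤ c) (h0 : ∀ n, P[D n | ℱ n] =ᵐ[P] 0) :
    ∀ᵐ ω ∂P, Tendsto (fun n : ℕ => (∑ i ∈ Finset.range n, D i ω) / n) atTop (𝓝 0) := by
  -- The weights `1 / (i + 1)` are square summable, so this martingale is bounded in `L^2` and
  -- converges almost surely; Kronecker's lemma then gives the averages.
  set M : ℕ → Ω → ℝ := fun n => ∑ i ∈ Finset.range n, ((i : ℝ) + 1)⁻¹ • D i with hM
  have hMsucc : ∀ n, M (n + 1) = M n + ((n : ℝ) + 1)⁻¹ • D n := fun n =>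
    Finset.sum_range_succ _ _
  have hMapply : ∀ n ω, M (n + 1) ω = M n ω + ((n : ℝ) + 1)⁻¹ * D n ω := fun n ω => by
    rw [hMsucc]; rfl
  have hMm : ∀ n, StronglyMeasurable[ℱ n] (M n) := fun n =>
    Finset.stronglyMeasurable_sum _ fun i hi =>
      ((hD i).mono (ℱ.mono (Finset.mem_range.mp hi))).const_smul _
  have hMm' : ∀ n, StronglyMeasurable (M n) := fun n => (hMm n).mono (ℱ.le n)
  have hDm' : ∀ n, StronglyMeasurable (D n) := fun n => (hD n).mono (ℱ.le _)
  have hDi : ∀ n, Integrable (D n) P := fun n =>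
    Integrable.of_bound (hDm' n).aestronglyMeasurable c (Eventually.of_forall (hc n))
  have hMb : ∀ n, ∃ b, ∀ ω, |M n ω| ≤ b := by
    intro n
    induction n with
    | zero => exact ⟨0, fun ω => by simp [hM]⟩
    | succ n ih =>
      obtain ⟨b, hb⟩ := ih
      refine ⟨b + |((n : ℝ) + 1)⁻¹| * c, fun ω => ?_⟩
      rw [hMapply]
      refine (abs_add_le _ _).trans (add_le_add (hb ω) ?_)
      rw [abs_mul]
      exact mul_le_mul_of_nonneg_left (hc n ω) (abs_nonneg _)
  have hMi : ∀ n, Integrable (M n) P := fun n => by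
    obtain ⟨b, hb⟩ := hMb n
    exact Integrable.of_bound (hMm' n).aestronglyMeasurable b (Eventually.of_forall hb)
  have hMMi : ∀ n, Integrable (fun ω => M n ω ^ 2) P := fun n => by
    obtain ⟨b, hb⟩ := hMb n
    refine Integrable.of_bound ((hMm' n).pow 2).aestronglyMeasurable (b ^ 2)
      (Eventually.of_forall fun ω => ?_)
    rw [Real.norm_eq_abs, abs_pow]
    exact pow_le_pow_left₀ (abs_nonneg _) (hb ω) 2
  have hDDi : ∀ n, Integrable (fun ω => D n ω ^ 2) P := fun n => by
    refine Integrable.of_bound ((hDm' n).pow 2).aestronglyMeasurable (c ^ 2)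
      (Eventually.of_forall fun ω => ?_)
    rw [Real.norm_eq_abs, abs_pow]
    exact pow_le_pow_left₀ (abs_nonneg _) (hc n ω) 2
  have hmart : Martingale M ℱ P := by
    refine martingale_of_condExp_sub_eq_zero_nat hMm hMi fun n => ?_
    rw [hMsucc, add_sub_cancel_left]
    filter_upwards [condExp_smul ((n : ℝ) + 1)⁻¹ (D n) (ℱ n) (μ := P), h0 n] with ω h1 h2
    rw [h1, Pi.smul_apply, h2]; simp
  have hMDi : ∀ n, Integrable (M n * D n) P := fun n => by
    obtain ⟨b, hb⟩ := hMb n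
    refine Integrable.of_bound ((hMm' n).mul (hDm' n)).aestronglyMeasurable (b * c)
      (Eventually.of_forall fun ω => ?_)
    rw [Pi.mul_apply, Real.norm_eq_abs, abs_mul]
    exact mul_le_mul (hb ω) (hc n ω) (abs_nonneg _) ((abs_nonneg _).trans (hb ω))
  have hMD : ∀ n, ∫ ω, M n ω * D n ω ∂P = 0 := fun n => by
    have h1 := condExp_mul_of_stronglyMeasurable_left (μ := P) (hMm n) (hMDi n) (hDi n)
    have h2 : P[M n * D n | ℱ n] =ᵐ[P] 0 := by
      filter_upwards [h1, h0 n] with ω h1 h2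
      rw [h1, Pi.mul_apply, h2]; simp
    have h3 := integral_condExp (μ := P) (f := M n * D n) (ℱ.le n)
    rw [integral_congr_ae h2] at h3
    simpa using h3.symm
  have hsumm : Summable fun i : ℕ => c ^ 2 * (((i : ℝ) + 1)⁻¹) ^ 2 := by
    have h := (summable_nat_add_iff 1).mpr (Real.summable_nat_pow_inv.mpr one_lt_two)
    refine (h.congr fun i => ?_).mul_left _
    push_cast
    rw [inv_pow]
  set S : ℝ := ∑' i : ℕ, c ^ 2 * (((i : ℝ) + 1)⁻¹) ^ 2 with hS
  have hM2 : ∀ n, ∫ ω, M n ω ^ 2 ∂P ≤ S := by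
    intro n
    refine le_trans ?_ (hsumm.sum_le_tsum (Finset.range n) fun i _ => by positivity)
    induction n with
    | zero => simp [hM]
    | succ n ih =>
      rw [Finset.sum_range_succ]
      set a := ((n : ℝ) + 1)⁻¹ with ha
      have hexp : ∀ ω, M (n + 1) ω ^ 2 =
          M n ω ^ 2 + 2 * a * (M n ω * D n ω) + a ^ 2 * D n ω ^ 2 := fun ω => by
        rw [hMapply]; ring
      have hD2 : ∫ ω, D n ω ^ 2 ∂P ≤ c ^ 2 := by
        have := integral_mono (hDDi n) (integrable_const (c ^ 2)) fun ω => by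
          have := pow_le_pow_left₀ (abs_nonneg _) (hc n ω) 2
          rwa [sq_abs] at this
        simpa using this
      have hi1 : Integrable (fun ω => 2 * a * (M n ω * D n ω)) P := (hMDi n).const_mul _
      have hi2 : Integrable (fun ω => M n ω ^ 2 + 2 * a * (M n ω * D n ω)) P :=
        (hMMi n).add hi1
      rw [integral_congr_ae (Eventually.of_forall hexp),
        integral_add hi2 ((hDDi n).const_mul _),
        integral_add (hMMi n) hi1, integral_const_mul, integral_const_mul, hMD]
      nlinarith [sq_nonneg a]
  have hbdd : ∀ n, eLpNorm (M n) 1 P ≤ ((1 + S).toNNReal : ℝ≥0∞) := by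
    intro n
    rw [eLpNorm_one_eq_lintegral_enorm, ← ofReal_integral_norm_eq_lintegral_enorm (hMi n)]
    refine ENNReal.ofReal_le_ofReal ?_
    have hi : Integrable (fun ω => 1 + M n ω ^ 2) P := (integrable_const 1).add (hMMi n)
    have h1 := integral_mono (hMi n).norm hi fun ω => by
      change |M n ω| ≤ 1 + M n ω ^ 2
      nlinarith [sq_abs (M n ω), sq_nonneg (|M n ω| - 1)]
    have h2 : ∫ ω, (1 + M n ω ^ 2) ∂P = 1 + ∫ ω, M n ω ^ 2 ∂P := by
      rw [integral_add (integrable_const 1) (hMMi n)]; simp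
    linarith [hM2 n]
  filter_upwards [hmart.submartingale.exists_ae_tendsto_of_bdd hbdd] with ω hω
  obtain ⟨l, hl⟩ := hω
  -- Summation by parts: the average of `D` is `M n` minus the Cesàro mean of `M`, and both have the
  -- limit `l`.
  have habel : ∀ n : ℕ, ∑ i ∈ Finset.range n, D i ω =
      n * M n ω - ∑ i ∈ Finset.range n, M i ω := by
    intro n
    induction n with
    | zero => simp
    | succ n ih =>
      rw [Finset.sum_range_succ, Finset.sum_range_succ, ih, hMapply]
      have : (n : ℝ) + 1 ≠ 0 := by positivity
      push_cast
      field_simp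
      ring
  have hlim := hl.sub hl.cesaro
  rw [sub_self] at hlim
  refine hlim.congr' ?_
  filter_upwards [eventually_ge_atTop 1] with n hn
  have hn0 : (n : ℝ) ≠ 0 := by positivity
  rw [habel]
  field_simp

/-! ### From the law of the walk to almost sure properties of its trajectories. -/

namespace IsWalk

variable {δ : ℕ → ℝ} {α : Matrix ℕ ℕ ℝ} {X : ℕ → Ω → ℕ} (hX : IsWalk P δ α X)
include hX

/-- The filtration generated by the walk. -/
noncomputable abbrev filtration : Filtration ℕ mΩ :=
  Filtration.natural X fun m => (hX.measurable m).stronglyMeasurable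

lemma measurable_filtration {m n : ℕ} (h : m ≤ n) : Measurable[hX.filtration n] (X m) :=
  ((Filtration.stronglyAdapted_natural
    fun m => (hX.measurable m).stronglyMeasurable) m).measurable.mono
      (hX.filtration.mono h) le_rfl

lemma measurable_weight (n j : ℕ) :
    Measurable[hX.filtration n] fun ω => weight δ α (fun m => X m ω) n j := by
  induction n with
  | zero => exact measurable_const
  | succ n ih =>
    simp only [weight]
    have h1 : Measurable[hX.filtration (n + 1)] (X (n + 1)) := hX.measurable_filtration le_rfl
    have h2 : Measurable[hX.filtration (n + 1)] (X n) := hX.measurable_filtration (by lia)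
    refine (ih.mono (hX.filtration.mono (Nat.le_succ n)) le_rfl).add
      (Measurable.ite (h1 (measurableSet_singleton 0))
        ((measurable_of_countable fun i => α i j).comp h2) measurable_const)

lemma measurable_jump (hδs : Summable δ) (hα : IsStochastic α) (n j : ℕ) :
    Measurable[hX.filtration n] fun ω => jump δ α (fun m => X m ω) n j := by
  have hroot : ∀ i ≤ n, MeasurableSet[hX.filtration n] {ω | X i ω = 0} := fun i hi =>
    hX.measurable_filtration hi (measurableSet_singleton 0)
  have htot : Measurable[hX.filtration n]
      fun ω => ∑' k, weight δ α (fun m => X m ω) n k := by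
    -- The infinite sum of the weights is replaced by a finite count of visits, whose measurability
    -- is elementary.
    simp only [(hasSum_weight hδs hα _ _).tsum_eq, total, atRoot]
    refine measurable_const.add (Finset.measurable_sum _ fun i hi => ?_)
    exact Measurable.ite (hroot (i + 1) (Finset.mem_range.mp hi)) measurable_const measurable_const
  exact Measurable.ite (hroot n le_rfl) ((hX.measurable_weight n j).div htot) measurable_const

/-- The walk is specified by its jumps to single vertices. Truncating `h` to finitely many vertices
and passing to the limit by dominated convergence extends this to bounded `h`. -/
lemma condExp_comp [IsProbabilityMeasure P] (hδ : ∀ i, 0 ≤ δ i) (hδs : Summable δ)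
    (hδ0 : 0 < ∑' i, δ i) (hα : IsStochastic α) {h : ℕ → ℝ} (h0 : ∀ i, 0 ≤ h i)
    (h1 : ∀ i, h i ≤ 1) (n : ℕ) :
    StronglyMeasurable[hX.filtration n] (fun ω => ∑' k, jump δ α (fun m => X m ω) n k * h k) ∧
    P[fun ω => h (X (n + 1) ω) | hX.filtration n] =ᵐ[P]
      fun ω => ∑' k, jump δ α (fun m => X m ω) n k * h k := by
  set p : ℕ → Ω → ℝ := fun k ω => jump δ α (fun m => X m ω) n k with hp
  have hp0 : ∀ k ω, 0 ≤ p k ω := fun k ω => jump_nonneg hδ hα _ _ _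
  have hpsum : ∀ ω, HasSum (fun k => p k ω) 1 := fun ω => hasSum_jump hδs hδ0 hα _ _
  have hphs : ∀ ω, Summable fun k => p k ω * h k := fun ω =>
    Summable.of_nonneg_of_le (fun k => mul_nonneg (hp0 k ω) (h0 k))
      (fun k => mul_le_of_le_one_right (hp0 k ω) (h1 k)) (hpsum ω).summable
  set I : ℕ → Ω → ℝ := fun k => (X (n + 1) ⁻¹' {k}).indicator fun _ => (1 : ℝ) with hI
  set fs : ℕ → Ω → ℝ := fun M => ∑ k ∈ Finset.range M, h k • I k with hfs
  set gs : ℕ → Ω → ℝ := fun M ω => ∑ k ∈ Finset.range M, p k ω * h k with hgs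
  have hfs_apply : ∀ M ω, fs M ω = if X (n + 1) ω < M then h (X (n + 1) ω) else 0 := by
    intro M ω
    simp only [hfs, hI, Finset.sum_apply, Pi.smul_apply, Set.indicator, Set.mem_preimage,
      Set.mem_singleton_iff, smul_eq_mul, mul_ite, mul_one, mul_zero]
    rw [Finset.sum_ite_eq]
    simp
  have hIi : ∀ k, Integrable (I k) P := fun k =>
    (integrable_const 1).indicator (hX.measurable _ (measurableSet_singleton k))
  have hfsi : ∀ M, Integrable (fs M) P := fun M =>
    integrable_finsetSum' _ fun k _ => (hIi k).smul _
  have hgsm : ∀ M, Measurable[hX.filtration n] (gs M) := fun M =>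
    Finset.measurable_sum _ fun k _ => (hX.measurable_jump hδs hα n k).mul_const _
  have hgs0 : ∀ M ω, 0 ≤ gs M ω := fun M ω =>
    Finset.sum_nonneg fun k _ => mul_nonneg (hp0 k ω) (h0 k)
  have hgs1 : ∀ M ω, gs M ω ≤ 1 := fun M ω =>
    (Finset.sum_le_sum fun k _ => mul_le_of_le_one_right (hp0 k ω) (h1 k)).trans
      (sum_le_hasSum _ (fun k _ => hp0 k ω) (hpsum ω))
  have hgsb : ∀ M, ∀ᵐ ω ∂P, ‖gs M ω‖ ≤ 1 := fun M => Eventually.of_forall fun ω => by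
    rw [Real.norm_of_nonneg (hgs0 M ω)]; exact hgs1 M ω
  have hgsi : ∀ M, Integrable (gs M) P := fun M =>
    Integrable.of_bound ((hgsm M).mono (hX.filtration.le n) le_rfl).aestronglyMeasurable 1
      (hgsb M)
  have hglim : ∀ ω, Tendsto (fun M => gs M ω) atTop (𝓝 (∑' k, p k ω * h k)) := fun ω =>
    (hphs ω).hasSum.tendsto_sum_nat
  have hgm : StronglyMeasurable[hX.filtration n] fun ω => ∑' k, p k ω * h k :=
    (@measurable_of_tendsto_metrizable _ _ (hX.filtration n) _ _ _ _ _ _ hgsm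
      (tendsto_pi_nhds.mpr hglim)).stronglyMeasurable
  have hgi : Integrable (fun ω => ∑' k, p k ω * h k) P := by
    refine Integrable.of_bound (hgm.mono (hX.filtration.le n)).aestronglyMeasurable 1
      (Eventually.of_forall fun ω => ?_)
    exact le_of_tendsto (hglim ω).norm (Eventually.of_forall fun M => by
      rw [Real.norm_of_nonneg (hgs0 M ω)]; exact hgs1 M ω)
  refine ⟨hgm, ?_⟩
  have hcond : ∀ M, P[fs M | hX.filtration n] =ᵐ[P] gs M := by
    intro M
    have hsum := condExp_finsetSum (μ := P) (s := Finset.range M) (f := fun k => h k • I k)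
      (fun k _ => (hIi k).smul (h k)) (hX.filtration n)
    have hk : ∀ᵐ ω ∂P, ∀ k, (P[h k • I k | hX.filtration n]) ω = p k ω * h k := by
      refine ae_all_iff.mpr fun k => ?_
      filter_upwards [condExp_smul (h k) (I k) (hX.filtration n) (μ := P), hX.transition n k]
        with ω e1 e2
      rw [e1, Pi.smul_apply, smul_eq_mul, mul_comm, e2]
      rfl
    filter_upwards [hsum, hk] with ω e1 e2
    rw [e1, Finset.sum_apply]
    exact Finset.sum_congr rfl fun k _ => e2 k
  have hlim := tendsto_condExp_unique (m := hX.filtration n) fs gs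
    (fun ω => h (X (n + 1) ω)) (fun ω => ∑' k, p k ω * h k) hfsi hgsi
    (Eventually.of_forall fun ω => by
      refine tendsto_const_nhds.congr' ?_
      filter_upwards [eventually_gt_atTop (X (n + 1) ω)] with M hM
      rw [hfs_apply, if_pos hM])
    (Eventually.of_forall hglim) (fun _ => 1) (integrable_const 1) (fun _ => 1)
    (integrable_const 1) (fun M => Eventually.of_forall fun ω => by
      rw [hfs_apply]
      split_ifs
      · rw [Real.norm_of_nonneg (h0 _)]; exact h1 _
      · simp) hgsb
    (fun M => by
      rw [condExp_of_stronglyMeasurable (hX.filtration.le n) (hgsm M).stronglyMeasurable (hgsi M)]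
      exact hcond M)
  rwa [condExp_of_stronglyMeasurable (hX.filtration.le n) hgm hgi] at hlim

lemma ae_tendsto_innovation [IsProbabilityMeasure P] (hδ : ∀ i, 0 ≤ δ i) (hδs : Summable δ)
    (hδ0 : 0 < ∑' i, δ i) (hα : IsStochastic α) {h : ℕ → ℝ} (h0 : ∀ i, 0 ≤ h i)
    (h1 : ∀ i, h i ≤ 1) :
    ∀ᵐ ω ∂P, Tendsto (fun n : ℕ =>
      (∑ i ∈ Finset.range n, innovation δ α (fun m => X m ω) h i) / n) atTop (𝓝 0) := by
  have hcomp := hX.condExp_comp hδ hδs hδ0 hα h0 h1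
  have hhm : ∀ n, Measurable[hX.filtration n] fun ω => h (X n ω) := fun n =>
    (measurable_of_countable h).comp (hX.measurable_filtration le_rfl)
  have hmean : ∀ n ω, 0 ≤ ∑' k, jump δ α (fun m => X m ω) n k * h k ∧
      ∑' k, jump δ α (fun m => X m ω) n k * h k ≤ 1 := fun n ω => by
    have hj0 := jump_nonneg hδ hα (fun m => X m ω) n
    have hj1 := hasSum_jump hδs hδ0 hα (fun m => X m ω) n
    have hle : ∀ k, jump δ α (fun m => X m ω) n k * h k ≤ jump δ α (fun m => X m ω) n k :=
      fun k => mul_le_of_le_one_right (hj0 k) (h1 k)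
    refine ⟨tsum_nonneg fun k => mul_nonneg (hj0 k) (h0 k), ?_⟩
    rw [← hj1.tsum_eq]
    exact (Summable.of_nonneg_of_le (fun k => mul_nonneg (hj0 k) (h0 k)) hle
      hj1.summable).tsum_le_tsum hle hj1.summable
  refine ae_tendsto_average_of_condExp_eq_zero (ℱ := hX.filtration) (c := 1)
    (D := fun n ω => innovation δ α (fun m => X m ω) h n) (fun n => ?_) (fun n ω => ?_)
    (fun n => ?_)
  · exact (hhm (n + 1)).stronglyMeasurable.sub
      ((hcomp n).1.mono (hX.filtration.mono (Nat.le_succ n)))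
  · obtain ⟨e1, e2⟩ := hmean n ω
    have e3 := h0 (X (n + 1) ω)
    have e4 := h1 (X (n + 1) ω)
    rw [innovation, abs_le]
    constructor <;> linarith
  · have hi1 : Integrable (fun ω => h (X (n + 1) ω)) P :=
      Integrable.of_bound
        ((hhm (n + 1)).mono (hX.filtration.le _) le_rfl).aestronglyMeasurable 1
        (Eventually.of_forall fun ω => by rw [Real.norm_of_nonneg (h0 _)]; exact h1 _)
    have hi2 : Integrable (fun ω => ∑' k, jump δ α (fun m => X m ω) n k * h k) P :=
      Integrable.of_bound ((hcomp n).1.mono (hX.filtration.le n)).aestronglyMeasurable 1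
        (Eventually.of_forall fun ω => by
          rw [Real.norm_of_nonneg (hmean n ω).1]; exact (hmean n ω).2)
    have hsub := condExp_sub hi1 hi2 (hX.filtration n)
    rw [condExp_of_stronglyMeasurable (hX.filtration.le n) (hcomp n).1 hi2] at hsub
    filter_upwards [hsub, (hcomp n).2] with ω e1 e2
    refine e1.trans ?_
    rw [Pi.sub_apply, e2, sub_self]
    rfl

lemma ae_isStarPath [IsProbabilityMeasure P] : ∀ᵐ ω ∂P, IsStarPath fun m => X m ω := by
  have hstep : ∀ n, ∀ᵐ ω ∂P, X n ω ≠ 0 → X (n + 1) ω = 0 := by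
    intro n
    set A : Set Ω := {ω | X n ω ≠ 0} with hA
    have hAm' : MeasurableSet[hX.filtration n] A :=
      hX.measurable_filtration le_rfl (measurableSet_singleton 0).compl
    have hAm : MeasurableSet A := hX.filtration.le n _ hAm'
    have hBm : MeasurableSet (X (n + 1) ⁻¹' {0}) := hX.measurable _ (measurableSet_singleton 0)
    have hi : Integrable ((X (n + 1) ⁻¹' {0}).indicator fun _ => (1 : ℝ)) P :=
      (integrable_const 1).indicator hBm
    -- On the event of being at a leaf, the conditional probability of a return is `1`; integrating
    -- over it leaves no mass for a failure to return.
    have h1 : ∫ ω in A, (X (n + 1) ⁻¹' {0}).indicator (fun _ => (1 : ℝ)) ω ∂P = P.real A := by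
      rw [← setIntegral_condExp (hX.filtration.le n) hi hAm',
        setIntegral_congr_ae (g := fun _ => (1 : ℝ)) hAm ?_]
      · simp
      · filter_upwards [hX.transition n 0] with ω hω hωA
        rw [hω, if_neg hωA, if_pos rfl]
    have h2 : P.real A = P.real (A ∩ X (n + 1) ⁻¹' {0}) + P.real (A \ X (n + 1) ⁻¹' {0}) :=
      (measureReal_inter_add_sdiff hBm).symm
    rw [setIntegral_indicator hBm, setIntegral_const, smul_eq_mul, mul_one] at h1
    have h3 : P.real (A \ X (n + 1) ⁻¹' {0}) = 0 := by linarith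
    rw [measureReal_eq_zero_iff] at h3
    rw [ae_iff]
    convert h3 using 2
    ext ω
    simp [hA]
  filter_upwards [hX.start, ae_all_iff.mpr hstep] with ω h1 h2
  exact ⟨h1, h2⟩

/-- The recursion is measurable on all of `Ω` and agrees almost surely with `updateTime`, which is
an infimum over an unbounded set of times. -/
lemma measurable_visitTime (k : ℕ) : Measurable fun ω => visitTime (fun m => X m ω) k := by
  have hnext : ∀ s, Measurable fun ω => nextVisit (fun m => X m ω) s := fun s =>
    Measurable.ite (hX.measurable (s + 1) (measurableSet_singleton 0)) measurable_const
      measurable_const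
  induction k with
  | zero => exact measurable_const
  | succ k ih =>
    have h : Measurable fun z : ℕ × Ω => nextVisit (fun m => X m z.2) z.1 :=
      measurable_from_prod_countable_right hnext
    exact h.comp (ih.prodMk measurable_id)

end IsWalk

end Probability

end StarVRRW

/-! ### Conclusion. -/

theorem theorem2 {Ω : Type*} [MeasurableSpace Ω] (P : Measure Ω) [IsProbabilityMeasure P]
    (δ : ℕ → ℝ) (hδ_nonneg : ∀ i, 0 ≤ δ i) (hδ_sum : Summable δ) (hδ_pos : 0 < ∑' i, δ i)
    (α : Matrix ℕ ℕ ℝ) (hα : StarVRRW.IsStochastic α) (hα_irr : α.IsIrreducible)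
    (hα_aper : StarVRRW.IsAperiodic α) (hα_erg : StarVRRW.IsUniformlyErgodic α)
    (π : ℕ → ℝ) (hπ : StarVRRW.IsStationaryDistribution α π)
    (X : ℕ → Ω → ℕ) (hX : StarVRRW.IsWalk P δ α X) :
    (∀ᵐ ω ∂P, Tendsto
        (fun n : ℕ => (StarVRRW.updateTime (fun m => X m ω) n : ℝ) / ((n : ℝ) + 1))
        atTop (𝓝 (2 - π 0))) ∧
    ((∀ n : ℕ, MemLp (fun ω => (StarVRRW.updateTime (fun m => X m ω) n : ℝ) / ((n : ℝ) + 1))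
        1 P) ∧
      Tendsto
        (fun n : ℕ => eLpNorm
          (fun ω => (StarVRRW.updateTime (fun m => X m ω) n : ℝ) / ((n : ℝ) + 1) - (2 - π 0)) 1 P)
        atTop (𝓝 0)) ∧
    (∀ j : ℕ, ∀ᵐ ω ∂P, Tendsto
        (fun n : ℕ => StarVRRW.weight δ α (fun m => X m ω) n j / ((n : ℝ) + ∑' i, δ i))
        atTop (𝓝 (π j / (2 - π 0)))) := by
  -- Only countably many pairs `(j, N)` occur, so one null set serves all levels and all columns.
  have hinn : ∀ᵐ ω ∂P, ∀ j N, Tendsto (fun n : ℕ => (∑ i ∈ Finset.range n,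
      StarVRRW.innovation δ α (fun m => X m ω) (fun u => StarVRRW.nStep α N u j) i) / n)
      atTop (𝓝 0) :=
    ae_all_iff.mpr fun j => ae_all_iff.mpr fun N =>
      hX.ae_tendsto_innovation hδ_nonneg hδ_sum hδ_pos hα (fun u => (hα.nStep N).nonneg u j)
        fun u => (hα.nStep N).le_one u j
  have hpath := hX.ae_isStarPath
  have hdev : ∀ᵐ ω ∂P, ∀ j,
      Tendsto (StarVRRW.deviation δ α π (fun m => X m ω) j 0) atTop (𝓝 0) := by
    filter_upwards [hinn, hpath] with ω h1 h2 j
    exact h2.tendsto_deviation hδ_nonneg hδ_sum hδ_pos hα hα_erg hπ (h1 j)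
  have hvis : ∀ᵐ ω ∂P, Tendsto
      (fun n : ℕ => (2 - π 0) * (StarVRRW.visits (fun m => X m ω) n / n)) atTop (𝓝 1) := by
    filter_upwards [hinn, hpath, hdev] with ω h1 h2 h3
    exact h2.tendsto_visits hδ_sum hα (h3 0) (h1 0 0)
  have hσ : ∀ᵐ ω ∂P, Tendsto
      (fun n : ℕ => (StarVRRW.updateTime (fun m => X m ω) n : ℝ) / ((n : ℝ) + 1))
      atTop (𝓝 (2 - π 0)) := by
    filter_upwards [hpath, hvis] with ω h1 h2
    exact h1.tendsto_updateTime h2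
  have hmeas : ∀ n : ℕ, AEStronglyMeasurable
      (fun ω => (StarVRRW.updateTime (fun m => X m ω) n : ℝ) / ((n : ℝ) + 1)) P := by
    intro n
    have hm : Measurable fun ω =>
        (StarVRRW.visitTime (fun m => X m ω) n : ℝ) / ((n : ℝ) + 1) :=
      ((measurable_of_countable fun k : ℕ => (k : ℝ)).comp
        (hX.measurable_visitTime n)).div_const _
    refine hm.aestronglyMeasurable.congr ?_
    filter_upwards [hpath] with ω h
    rw [h.updateTime_eq]
  -- Successive updates are at most two steps apart, which gives the constant domination behind the
  -- convergence in `L^1`.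
  have hbound : ∀ n : ℕ, ∀ᵐ ω ∂P,
      ‖(StarVRRW.updateTime (fun m => X m ω) n : ℝ) / ((n : ℝ) + 1)‖ ≤ 2 := by
    intro n
    filter_upwards [hpath] with ω h
    rw [Real.norm_of_nonneg (by positivity), div_le_iff₀ (by positivity)]
    have : (StarVRRW.updateTime (fun m => X m ω) n : ℝ) ≤ 2 * n := by
      exact_mod_cast h.updateTime_le n
    linarith
  refine ⟨hσ, ⟨fun n => MemLp.of_bound (hmeas n) 2 (hbound n), ?_⟩, fun j => ?_⟩
  · have hlim := tendsto_lintegral_of_dominated_convergence' (μ := P)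
      (F := fun (n : ℕ) ω =>
        ‖(StarVRRW.updateTime (fun m => X m ω) n : ℝ) / ((n : ℝ) + 1) - (2 - π 0)‖ₑ)
      (f := fun _ => 0) (fun _ => ENNReal.ofReal (2 + ‖2 - π 0‖))
      (fun n => ((hmeas n).sub aestronglyMeasurable_const).enorm)
      (fun n => by
        filter_upwards [hbound n] with ω h
        rw [← ofReal_norm]
        exact ENNReal.ofReal_le_ofReal ((norm_sub_le _ _).trans (by linarith)))
      (by simp)
      (by
        filter_upwards [hσ] with ω h
        have := (h.sub_const (2 - π 0)).enorm
        simpa using this)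
    simpa [eLpNorm_one_eq_lintegral_enorm] using hlim
  · filter_upwards [hpath, hvis, hdev] with ω h1 h2 h3
    exact h1.tendsto_weight hδ_pos hπ (h3 j) h2
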